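/- Let $H$ be an invertible Hermitian complex $n\times n$ matrix, let $[x,y]=(Hx,y)$ be the associated indefinite inner product on $\mathbb{C}^n$ (where $(\cdot,\cdot)$ is the Euclidean inner product), and let $B_0$ be a nilpotent complex $n\times n$ matrix that is $H$-nonnegative, i.e. $[B_0x,x]\ge 0$ for all $x\in\mathbb{C}^n$. Write $J_k(\lambda)$ for the $k\times k$ Jordan block with eigenvalue $\lambda$ ($J_0(0)$ being empty). Jordan forms are considered up to the order of their blocks. The Segre characteristic of $B_0$ is the collection of sizes, with repetition, of the Jordan blocks in the Jordan form of $B_0$. A Segre pairing of $B_0$ is a finite collection $\mathcal{S}$ (with repetition, the order being immaterial) of pairs $(a,b)$ of nonnegative integers such that $a\ge 1$, $a\ge b$ and $a-b\le 1$ for every pair, and such that the nonzero entries of all the pairs of $\mathcal{S}$, counted with repetition, are exactly the entries of the Segre characteristic of $B_0$. A square root of $B_0$ is a complex $n\times n$ matrix $A_0$ with $A_0^2=B_0$. A square root $A_0$ of $B_0$ is said to be associated with $\mathcal{S}$ if there is an invertible matrix $P$ such that $$P^{-1}B_0P=\bigoplus_{(a,b)\in\mathcal{S}}\bigl(J_a(0)\oplus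 J_b(0)\bigr),\qquad P^{-1}A_0P=\bigoplus_{(a,b)\in\mathcal{S}}X_{(a,b)},$$ where the sums run over the pairs with repetition, each $X_{(a,b)}$ is a square root of the corresponding block $J_a(0)\oplus J_b(0)$ (possibly a different one for different occurrences of the same pair), and, by agreement, the zero matrix is not allowed as $X_{(1,1)}$. Then there is a one-to-one correspondence between the Segre pairings of $B_0$ and the Jordan forms of the square roots $A_0$ of $B_0$: there is a bijection $\Phi$ from the set of Segre pairings of $B_0$ onto the set of Jordan forms of all square roots of $B_0$ such that, for every Segre pairing $\mathcal{S}$ of $B_0$, square roots of $B_0$ associated with $\mathcal{S}$ exist, and all of them have Jordan form $\Phi(\mathcal{S})$. (Both sets are empty if $B_0$ has no square root.) -/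

import Mathlib

open scoped ComplexOrder

namespace IndefiniteRoots

/-- The indefinite inner product `[x, y] = (H x, y)` on `ℂⁿ`, where `(u, v) = v* u`. -/
def indefInner {n : ℕ} (H : Matrix (Fin n) (Fin n) ℂ) (x y : Fin n → ℂ) : ℂ :=
  star y ⬝ᵥ (H.mulVec x)

/-- `B` is `H`-nonnegative: `[B x, x]` is real and nonnegative for all `x`
(the order on `ℂ` is `z ≤ w ↔ z.re ≤ w.re ∧ z.im = w.im`). -/
def IsHNonneg {n : ℕ} (H B : Matrix (Fin n) (Fin n) ℂ) : Prop :=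
  ∀ x : Fin n → ℂ, 0 ≤ indefInner H (B.mulVec x) x

/-- The upper triangular `k × k` Jordan block with eigenvalue `c`. -/
def jordanBlock (k : ℕ) (c : ℂ) : Matrix (Fin k) (Fin k) ℂ :=
  Matrix.of fun i j => if i = j then c else if (i : ℕ) + 1 = (j : ℕ) then 1 else 0

/-- The direct sum of the Jordan blocks whose (size, eigenvalue) pairs are listed in `l`. -/
def jordanMatrix (l : List (ℕ × ℂ)) :
    Matrix (Σ i : Fin l.length, Fin (l.get i).1) (Σ i : Fin l.length, Fin (l.get i).1) ℂ :=
  Matrix.blockDiagonal' fun i => jordanBlock (l.get i).1 (l.get i).2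

/-- `J`, a multiset of (size, eigenvalue) pairs, is the Jordan form of `A`: all sizes are
positive and `A` is similar to the direct sum of the corresponding Jordan blocks.  A multiset is
used because the Jordan form is determined only up to the order of its blocks. -/
def HasJordanForm {n : ℕ} (A : Matrix (Fin n) (Fin n) ℂ) (J : Multiset (ℕ × ℂ)) : Prop :=
  ∃ l : List (ℕ × ℂ), (l : Multiset (ℕ × ℂ)) = J ∧ (∀ b ∈ l, 0 < b.1) ∧
    ∃ (P : Matrix (Fin n) (Σ i : Fin l.length, Fin (l.get i).1) ℂ)
      (Q : Matrix (Σ i : Fin l.length, Fin (l.get i).1) (Fin n) ℂ),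
      P * Q = 1 ∧ Q * P = 1 ∧ A = P * jordanMatrix l * Q

/-- `s` is the Segre characteristic of `B` at the eigenvalue `c`: the sizes, with repetition,
of the Jordan blocks with eigenvalue `c` in the Jordan form of `B`. -/
def HasSegreChar {n : ℕ} (B : Matrix (Fin n) (Fin n) ℂ) (c : ℂ) (s : Multiset ℕ) : Prop :=
  ∃ J : Multiset (ℕ × ℂ), HasJordanForm B J ∧
    ∃ T : Multiset (ℕ × ℂ), (∀ b ∈ T, b.2 ≠ c) ∧ J = s.map (fun k => (k, c)) + T

/-- `S` is a Segre pairing for the Segre characteristic `s`.  The first condition says that each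
pair is decreasing, has a nonzero first entry, and that its entries differ by at most one; the
second that, zeros discarded, the entries of the pairs in `S` are exactly the entries of `s`, each
used exactly once.  A multiset of pairs is the same as a lexicographically ordered list of pairs. -/
def IsSegrePairing (s : Multiset ℕ) (S : Multiset (ℕ × ℕ)) : Prop :=
  (∀ p ∈ S, 0 < p.1 ∧ p.2 ≤ p.1 ∧ p.1 ≤ p.2 + 1) ∧
    (S.map Prod.fst + S.map Prod.snd).filter (fun k => k ≠ 0) = s

/-- The Segre pairings of a nilpotent matrix `B`. -/
def segrePairings {n : ℕ} (B : Matrix (Fin n) (Fin n) ℂ) : Set (Multiset (ℕ × ℕ)) :=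
  {S | ∃ s : Multiset ℕ, HasSegreChar B 0 s ∧ IsSegrePairing s S}

/-- The Jordan forms of the square roots of `B`. -/
def sqrtJordanForms {n : ℕ} (B : Matrix (Fin n) (Fin n) ℂ) : Set (Multiset (ℕ × ℂ)) :=
  {J | ∃ A : Matrix (Fin n) (Fin n) ℂ, A * A = B ∧ HasJordanForm A J}

/-- The matrix `J_a(0) ⊕ J_b(0)` attached to the pair `p = (a, b)` (an empty block if `b = 0`). -/
def pairBlock (p : ℕ × ℕ) : Matrix (Fin p.1 ⊕ Fin p.2) (Fin p.1 ⊕ Fin p.2) ℂ :=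
  Matrix.fromBlocks (jordanBlock p.1 0) 0 0 (jordanBlock p.2 0)

/-- `X` is an admissible square root for the pair `p = (a, b)`: a square root of
`J_a(0) ⊕ J_b(0)`, where for `p = (1, 1)` the zero matrix is not allowed. -/
def IsPairSqrt (p : ℕ × ℕ) (X : Matrix (Fin p.1 ⊕ Fin p.2) (Fin p.1 ⊕ Fin p.2) ℂ) : Prop :=
  X * X = pairBlock p ∧ (p = (1, 1) → X ≠ 0)

/-- `A` is a square root of `B` associated with the collection of pairs `S`: in a basis in which
`B` is the direct sum of the blocks `J_a(0) ⊕ J_b(0)`, `(a, b) ∈ S`, the matrix `A` is the direct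
sum of admissible square roots of these blocks. -/
def IsAssociatedSqrt {n : ℕ} (B : Matrix (Fin n) (Fin n) ℂ) (S : Multiset (ℕ × ℕ))
    (A : Matrix (Fin n) (Fin n) ℂ) : Prop :=
  ∃ l : List (ℕ × ℕ), (l : Multiset (ℕ × ℕ)) = S ∧
    ∃ (X : ∀ i : Fin l.length,
          Matrix (Fin (l.get i).1 ⊕ Fin (l.get i).2) (Fin (l.get i).1 ⊕ Fin (l.get i).2) ℂ)
      (P : Matrix (Fin n) (Σ i : Fin l.length, Fin (l.get i).1 ⊕ Fin (l.get i).2) ℂ)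
      (Q : Matrix (Σ i : Fin l.length, Fin (l.get i).1 ⊕ Fin (l.get i).2) (Fin n) ℂ),
      (∀ i, IsPairSqrt (l.get i) (X i)) ∧ P * Q = 1 ∧ Q * P = 1 ∧
        B = P * Matrix.blockDiagonal' (fun i => pairBlock (l.get i)) * Q ∧
        A = P * Matrix.blockDiagonal' X * Q

end IndefiniteRoots

/-! Everything happens at the eigenvalue `0`, because a square root of a nilpotent matrix is
nilpotent. The key fact (`IsPairSqrt.similar`) is that an admissible square root of `J_a(0) ⊕
J_b(0)` with `a - b ∈ {0, 1}` is a single block `J_{a+b}(0)`. Since similar matrices have similar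
squares and such roots exist (`exists_isPairSqrt`), the square of `J_k(0)` in turn splits as
`J_⌈k/2⌉(0) ⊕ J_⌊k/2⌋(0)`. Hence `Φ` replaces each pair `(a, b)` by a block of size `a + b`. Its
inverse sends a size `k` to `(⌈k/2⌉, ⌊k/2⌋)`, the only admissible pair with sum `k`. Applied to the
Jordan form of a root, this inverse gives a Segre pairing (`exists_segrePairing_of_sqrt`). -/

namespace IndefiniteRoots

open Matrix Finset

/-! ### Similarity across index types -/

section Similar

variable {m n p : Type*} [Fintype m] [Fintype n] [Fintype p]
  [DecidableEq m] [DecidableEq n] [DecidableEq p]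

/-- Similarity of square matrices over `ℂ`, allowing different index types. -/
def Similar (A : Matrix m m ℂ) (B : Matrix n n ℂ) : Prop :=
  ∃ (P : Matrix m n ℂ) (Q : Matrix n m ℂ), P * Q = 1 ∧ Q * P = 1 ∧ A = P * B * Q

lemma Similar.symm {A : Matrix m m ℂ} {B : Matrix n n ℂ} (h : Similar A B) : Similar B A := by
  obtain ⟨P, Q, hPQ, hQP, rfl⟩ := h
  refine ⟨Q, P, hQP, hPQ, ?_⟩
  rw [show Q * (P * B * Q) * P = (Q * P) * B * (Q * P) by simp only [Matrix.mul_assoc], hQP]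
  simp

lemma Similar.trans {A : Matrix m m ℂ} {B : Matrix n n ℂ} {C : Matrix p p ℂ}
    (h : Similar A B) (h' : Similar B C) : Similar A C := by
  obtain ⟨P, Q, hPQ, hQP, rfl⟩ := h
  obtain ⟨R, S, hRS, hSR, rfl⟩ := h'
  refine ⟨P * R, S * Q, ?_, ?_, by simp only [Matrix.mul_assoc]⟩
  · rw [show P * R * (S * Q) = P * (R * S) * Q by simp only [Matrix.mul_assoc], hRS,
      Matrix.mul_one, hPQ]
  · rw [show S * Q * (P * R) = S * (Q * P) * R by simp only [Matrix.mul_assoc], hQP,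
      Matrix.mul_one, hSR]

lemma similar_submatrix (A : Matrix m m ℂ) (e : n ≃ m) : Similar (A.submatrix e e) A := by
  refine ⟨(1 : Matrix m m ℂ).submatrix e id, (1 : Matrix m m ℂ).submatrix id e, ?_, ?_, ?_⟩
  · rw [← Matrix.submatrix_mul _ _ _ _ _ Function.bijective_id, Matrix.one_mul,
      Matrix.submatrix_one_equiv]
  · rw [← Matrix.submatrix_mul _ _ _ _ _ e.bijective, Matrix.one_mul, Matrix.submatrix_id_id]
  · conv_rhs => rw [← Matrix.submatrix_id_id A]
    rw [← Matrix.submatrix_mul _ _ _ _ _ Function.bijective_id,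
      ← Matrix.submatrix_mul _ _ _ _ _ Function.bijective_id, Matrix.one_mul, Matrix.mul_one]

lemma Similar.pow_eq_zero {A : Matrix m m ℂ} {B : Matrix n n ℂ} (h : Similar A B) {k : ℕ}
    (hA : A ^ k = 0) : B ^ k = 0 := by
  obtain ⟨P, Q, hPQ, hQP, rfl⟩ := h.symm
  have key : ∀ k : ℕ, (P * A * Q) ^ k = P * A ^ k * Q := by
    intro k
    induction k with
    | zero => simp [hPQ]
    | succ k ih =>
      rw [pow_succ, ih, pow_succ, show P * A ^ k * Q * (P * A * Q) = P * (A ^ k * (Q * P) * A) * Q by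
        simp only [Matrix.mul_assoc], hQP, Matrix.mul_one]
  rw [key, hA]
  simp

lemma Similar.isNilpotent {A : Matrix m m ℂ} {B : Matrix n n ℂ} (h : Similar A B)
    (hA : IsNilpotent A) : IsNilpotent B :=
  let ⟨k, hk⟩ := hA
  ⟨k, h.pow_eq_zero hk⟩

lemma Similar.mul_self {A : Matrix m m ℂ} {B : Matrix n n ℂ} (h : Similar A B) :
    Similar (A * A) (B * B) := by
  obtain ⟨P, Q, hPQ, hQP, rfl⟩ := h
  refine ⟨P, Q, hPQ, hQP, ?_⟩
  rw [show P * B * Q * (P * B * Q) = P * (B * (Q * P) * B) * Q by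
    simp only [Matrix.mul_assoc], hQP, Matrix.mul_one]

lemma Similar.blockDiagonal' {ι : Type*} [Fintype ι] [DecidableEq ι] {r s : ι → Type*}
    [∀ i, Fintype (r i)] [∀ i, DecidableEq (r i)] [∀ i, Fintype (s i)] [∀ i, DecidableEq (s i)]
    {M : ∀ i, Matrix (r i) (r i) ℂ} {N : ∀ i, Matrix (s i) (s i) ℂ}
    (h : ∀ i, Similar (M i) (N i)) :
    Similar (Matrix.blockDiagonal' M) (Matrix.blockDiagonal' N) := by
  choose P Q hPQ hQP hM using h
  refine ⟨Matrix.blockDiagonal' P, Matrix.blockDiagonal' Q, ?_, ?_, ?_⟩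
  · rw [← Matrix.blockDiagonal'_mul, funext hPQ]
    exact Matrix.blockDiagonal'_one
  · rw [← Matrix.blockDiagonal'_mul, funext hQP]
    exact Matrix.blockDiagonal'_one
  · rw [← Matrix.blockDiagonal'_mul, ← Matrix.blockDiagonal'_mul, funext hM]

end Similar

lemma blockDiagonal'_submatrix_sigmaMap {ι κ : Type*} [DecidableEq ι] [DecidableEq κ]
    {r : κ → Type*} (M : ∀ i, Matrix (r i) (r i) ℂ) {h : ι → κ} (hh : Function.Injective h) :
    (Matrix.blockDiagonal' M).submatrix
        (fun x : Σ i, r (h i) => (⟨h x.1, x.2⟩ : Σ i, r i)) (fun x => ⟨h x.1, x.2⟩) =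
      Matrix.blockDiagonal' fun i => M (h i) := by
  ext ⟨i, x⟩ ⟨j, y⟩
  by_cases hij : i = j
  · subst hij
    simp
  · rw [Matrix.submatrix_apply, Matrix.blockDiagonal'_apply_ne _ _ _ hij,
      Matrix.blockDiagonal'_apply_ne _ _ _ (hh.ne hij)]

/-- Equal multiplicities make corresponding fibres equinumerous; bijections of fibres glue. -/
lemma exists_equiv_of_map_univ_eq {ι κ α : Type*} [Fintype ι] [Fintype κ] {f : ι → α} {g : κ → α}
    (h : univ.val.map f = univ.val.map g) : ∃ e : ι ≃ κ, g ∘ e = f := by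
  classical
  have hc : ∀ b, Fintype.card {i // f i = b} = Fintype.card {k // g k = b} := by
    intro b
    have := congrArg (Multiset.count b) h
    simp only [Multiset.count_map, eq_comm (a := b)] at this
    rw [Fintype.card_subtype, Fintype.card_subtype]
    exact this
  have E : ∀ b, {i // f i = b} ≃ {k // g k = b} := fun b => Fintype.equivOfCardEq (hc b)
  refine ⟨(Equiv.sigmaFiberEquiv f).symm.trans
    ((Equiv.sigmaCongrRight E).trans (Equiv.sigmaFiberEquiv g)), funext fun i => ?_⟩
  exact (E (f i) ⟨i, rfl⟩).2

lemma map_univ_get {α : Type*} (l : List α) :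
    univ.val.map l.get = (l : Multiset α) := by
  rw [Fin.univ_val_map, List.ofFn_get]

/-! ### Direct sums of Jordan blocks with empty blocks allowed -/

section JordanSum

variable {ι κ : Type*} [Fintype ι] [DecidableEq ι] [Fintype κ] [DecidableEq κ]

/-- The direct sum of Jordan blocks, indexed by an arbitrary type; empty blocks are allowed. -/
def jordanSum (f : ι → ℕ × ℂ) : Matrix (Σ i, Fin (f i).1) (Σ i, Fin (f i).1) ℂ :=
  Matrix.blockDiagonal' fun i => jordanBlock (f i).1 (f i).2

/-- An empty block contributes no index, so omitting it only relabels the basis. This accommodates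
pairs `(a, 0)`. -/
lemma jordanSum_comp_similar (f : ι → ℕ × ℂ) {h : κ → ι} (hh : Function.Injective h)
    (hr : ∀ i, 0 < (f i).1 → i ∈ Set.range h) : Similar (jordanSum (f ∘ h)) (jordanSum f) := by
  let F : (Σ k, Fin (f (h k)).1) → Σ i, Fin (f i).1 := fun x => ⟨h x.1, x.2⟩
  have hF : Function.Bijective F := by
    constructor
    · rintro ⟨i, x⟩ ⟨j, y⟩ hxy
      obtain ⟨h1, h2⟩ := Sigma.mk.inj_iff.1 hxy
      obtain rfl := hh h1
      exact congrArg (Sigma.mk i) (eq_of_heq h2)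
    · rintro ⟨i, x⟩
      obtain ⟨k, rfl⟩ := hr i x.pos
      exact ⟨⟨k, x⟩, rfl⟩
  have := similar_submatrix (jordanSum f) (Equiv.ofBijective F hF)
  rwa [show (jordanSum f).submatrix (Equiv.ofBijective F hF) (Equiv.ofBijective F hF) =
    jordanSum (f ∘ h) from blockDiagonal'_submatrix_sigmaMap _ hh] at this

lemma jordanSum_similar_of_list (f : ι → ℕ × ℂ) {l : List (ℕ × ℂ)}
    (hl : (l : Multiset (ℕ × ℂ)) = (univ.val.map f).filter (fun b => 0 < b.1)) :
    Similar (jordanMatrix l) (jordanSum f) := by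
  have h : univ.val.map l.get = univ.val.map (fun i : {i // 0 < (f i).1} => f i) := by
    rw [map_univ_get, hl, Multiset.filter_map]
    exact (Finset.univ_val_map_subtype_restrict f fun i => 0 < (f i).1).symm
  obtain ⟨e, he⟩ := exists_equiv_of_map_univ_eq h
  have h1 : Similar (jordanSum (f ∘ fun j => (e j : ι))) (jordanSum f) :=
    jordanSum_comp_similar f (Subtype.val_injective.comp e.injective)
      fun i hi => ⟨e.symm ⟨i, hi⟩, by simp⟩
  rwa [show (f ∘ fun j => (e j : ι)) = l.get from he] at h1

lemma hasJordanForm_filter_iff {n : ℕ} (A : Matrix (Fin n) (Fin n) ℂ) (f : ι → ℕ × ℂ) :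
    HasJordanForm A ((univ.val.map f).filter (fun b => 0 < b.1)) ↔ Similar A (jordanSum f) := by
  constructor
  · rintro ⟨l, hl, -, hA⟩
    exact Similar.trans hA (jordanSum_similar_of_list f hl)
  · intro h
    set J := (univ.val.map f).filter (fun b => 0 < b.1) with hJ
    have hl : (J.toList : Multiset (ℕ × ℂ)) = J := J.coe_toList
    refine ⟨J.toList, hl, fun b hb => ?_, h.trans (jordanSum_similar_of_list f hl).symm⟩
    rw [Multiset.mem_toList, hJ] at hb
    exact (Multiset.mem_filter.1 hb).2

end JordanSum

/-! ### Jordan forms of nilpotent matrices -/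

lemma eq_zero_of_isNilpotent_jordanBlock {k : ℕ} (hk : 0 < k) {c : ℂ}
    (h : IsNilpotent (jordanBlock k c)) : c = 0 := by
  have hdet : (jordanBlock k c).det = c ^ k := by
    rw [Matrix.det_of_isUpperTriangular]
    · simp [jordanBlock]
    · intro i j hij
      have : (j : ℕ) < i := hij
      simp only [jordanBlock, Matrix.of_apply]
      rw [if_neg (by rintro rfl; omega), if_neg (by omega)]
  have : Nonempty (Fin k) := ⟨⟨0, hk⟩⟩
  obtain ⟨m, hm⟩ := h
  have := congrArg Matrix.det hm
  rw [Matrix.det_pow, hdet, Matrix.det_zero] at this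
  exact eq_zero_of_pow_eq_zero (eq_zero_of_pow_eq_zero this)

lemma HasJordanForm.snd_eq_zero {n : ℕ} {A : Matrix (Fin n) (Fin n) ℂ} {J : Multiset (ℕ × ℂ)}
    (h : HasJordanForm A J) (hA : IsNilpotent A) : ∀ b ∈ J, b.2 = 0 := by
  obtain ⟨l, rfl, hpos, hsim⟩ := h
  obtain ⟨k, hk⟩ := Similar.isNilpotent hsim hA
  intro b hb
  obtain ⟨i, rfl⟩ := List.get_of_mem (Multiset.mem_coe.1 hb)
  refine eq_zero_of_isNilpotent_jordanBlock (hpos _ hb) ⟨k, ?_⟩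
  rw [jordanMatrix, ← Matrix.blockDiagonal'_pow, ← Matrix.blockDiagonal'_zero] at hk
  exact congrFun (Matrix.blockDiagonal'_injective hk) i

lemma hasSegreChar_zero_iff {n : ℕ} {B : Matrix (Fin n) (Fin n) ℂ} (hB : IsNilpotent B)
    (s : Multiset ℕ) : HasSegreChar B 0 s ↔ HasJordanForm B (s.map fun k => (k, 0)) := by
  constructor
  · rintro ⟨J, hJ, T, hT, rfl⟩
    have : T = 0 := Multiset.eq_zero_of_forall_notMem fun b hb =>
      hT b hb (hJ.snd_eq_zero hB b (Multiset.mem_add.2 (Or.inr hb)))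
    simpa [this] using hJ
  · intro h
    exact ⟨_, h, 0, by simp, by simp⟩

lemma pow_card_eq_zero_of_isNilpotent {m : Type*} [Fintype m] [DecidableEq m]
    {X : Matrix m m ℂ} (hX : IsNilpotent X) : X ^ Fintype.card m = 0 := by
  -- `ℂ[X]` is reduced, so the characteristic polynomial is a pure power of the variable;
  -- Cayley–Hamilton finishes.
  have h := (Matrix.isNilpotent_charpoly_sub_pow_of_isNilpotent hX).eq_zero
  have h' := Matrix.aeval_self_charpoly X
  rwa [sub_eq_zero.1 h, map_pow, Polynomial.aeval_X] at h'

/-- The chain `X^(k-1) v, …, X v, v` is a Jordan basis; its vectors are the columns of `P`. -/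
lemma similar_jordanBlock_of_mulVec_ne_zero {k : ℕ} {X : Matrix (Fin k) (Fin k) ℂ}
    (hX : X ^ k = 0) {v : Fin k → ℂ} (hv : X ^ (k - 1) *ᵥ v ≠ 0) :
    Similar X (jordanBlock k 0) := by
  set P : Matrix (Fin k) (Fin k) ℂ := Matrix.of fun i j => (X ^ (k - 1 - (j : ℕ)) *ᵥ v) i with hP
  have hXP : X * P = P * jordanBlock k 0 := by
    ext i j
    have h1 : (X * P) i j = (X ^ (k - 1 - (j : ℕ) + 1) *ᵥ v) i := by
      rw [pow_succ', ← Matrix.mulVec_mulVec]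
      rfl
    rw [h1, Matrix.mul_apply]
    rcases Nat.eq_zero_or_pos (j : ℕ) with hj | hj
    · rw [show k - 1 - (j : ℕ) + 1 = k by have := j.pos; omega, hX, Finset.sum_eq_zero]
      · simp
      · intro l _
        simp [jordanBlock, hj]
    · rw [Finset.sum_eq_single (⟨j - 1, by omega⟩ : Fin k)]
      · have hne : (⟨j - 1, by omega⟩ : Fin k) ≠ j := by
          intro h
          have := congrArg Fin.val h
          simp only at this
          omega
        simp only [hP, jordanBlock, Matrix.of_apply, if_neg hne]
        rw [if_pos (by omega), mul_one, show k - 1 - (j - 1 : ℕ) = k - 1 - j + 1 by omega]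
      · intro l _ hl
        have : (l : ℕ) + 1 ≠ j := fun h => hl (Fin.ext (by simp only; omega))
        simp [jordanBlock, this]
      · simp
  have hinj : Function.Injective P.mulVec := by
    rw [← Matrix.coe_mulVecLin, ← LinearMap.ker_eq_bot, LinearMap.ker_eq_bot']
    intro w hw
    have hsum : ∀ r : ℕ, ∑ j, w j • (X ^ (r + (k - 1 - (j : ℕ))) *ᵥ v) = 0 := by
      intro r
      have h1 : P *ᵥ w = ∑ j, w j • (X ^ (k - 1 - (j : ℕ)) *ᵥ v) := by
        ext i
        simp [Matrix.mulVec_eq_sum, hP]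
      have h2 := congrArg (X ^ r).mulVecLin (h1.symm.trans hw)
      simpa [map_sum, Matrix.mulVec_mulVec, ← pow_add] using h2
    -- Take the largest `j` with `w j ≠ 0`. Applying `X ^ j` to the relation kills all terms of
    -- smaller index and leaves `w j • X^(k-1) v`.
    by_contra hne
    obtain ⟨j₀, hj₀⟩ := Function.ne_iff.1 hne
    obtain ⟨j, hj, hmax⟩ := (univ.filter fun j => w j ≠ 0).exists_max_image id
      ⟨j₀, by simpa using hj₀⟩
    have hwj : w j ≠ 0 := (Finset.mem_filter.1 hj).2
    have := hsum j
    rw [Finset.sum_eq_single j] at this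
    · rw [show (j : ℕ) + (k - 1 - j) = k - 1 by omega] at this
      exact (smul_ne_zero hwj hv) this
    · intro l _ hl
      by_cases hwl : w l = 0
      · simp [hwl]
      · have h1 : l ≤ j := hmax l (by simpa using hwl)
        have h2 : (l : ℕ) < j := lt_of_le_of_ne h1 (fun h => hl (Fin.ext h))
        rw [pow_eq_zero_of_le (show k ≤ (j : ℕ) + (k - 1 - l) by omega) hX]
        simp
    · simp
  have hdet := (Matrix.isUnit_iff_isUnit_det P).1 (Matrix.mulVec_injective_iff_isUnit.1 hinj)
  refine ⟨P, P⁻¹, Matrix.mul_nonsing_inv _ hdet, Matrix.nonsing_inv_mul _ hdet, ?_⟩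
  rw [← hXP, Matrix.mul_assoc, Matrix.mul_nonsing_inv _ hdet, Matrix.mul_one]

lemma similar_jordanBlock_of_pow_ne_zero {m : Type*} [Fintype m] [DecidableEq m] {k : ℕ}
    (hk : Fintype.card m = k) {X : Matrix m m ℂ} (hX : IsNilpotent X) (hX' : X ^ (k - 1) ≠ 0) :
    Similar X (jordanBlock k 0) := by
  have hs := similar_submatrix X (Fintype.equivFinOfCardEq hk).symm
  refine hs.symm.trans ?_
  have h0 : (X.submatrix (Fintype.equivFinOfCardEq hk).symm
      (Fintype.equivFinOfCardEq hk).symm) ^ (k - 1) ≠ 0 := fun h => hX' (hs.pow_eq_zero h)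
  obtain ⟨v, hv⟩ : ∃ v, (X.submatrix (Fintype.equivFinOfCardEq hk).symm
      (Fintype.equivFinOfCardEq hk).symm) ^ (k - 1) *ᵥ v ≠ 0 := by
    by_contra! h
    exact h0 (Matrix.ext_of_mulVec_single fun i => by rw [h, Matrix.zero_mulVec])
  refine similar_jordanBlock_of_mulVec_ne_zero ?_ hv
  simpa using pow_card_eq_zero_of_isNilpotent (hs.symm.isNilpotent hX)

/-! ### Square roots of `J_a(0) ⊕ J_b(0)` -/

lemma jordanBlock_zero_pow_apply (k r : ℕ) (i j : Fin k) :
    (jordanBlock k 0 ^ r) i j = if (i : ℕ) + r = j then 1 else 0 := by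
  induction r generalizing i with
  | zero => simp [Matrix.one_apply, Fin.ext_iff]
  | succ r ih =>
    rw [pow_succ', Matrix.mul_apply]
    have h1 : ∀ l, jordanBlock k 0 i l = if (i : ℕ) + 1 = l then 1 else 0 := by
      intro l
      by_cases h : i = l
      · simp [jordanBlock, h]
      · simp [jordanBlock, h]
    simp only [h1, ih]
    by_cases hi : (i : ℕ) + 1 < k
    · rw [Finset.sum_eq_single (⟨i + 1, hi⟩ : Fin k)]
      · simp only [if_true, one_mul]
        congr 1
        simp only [eq_iff_iff]
        omega
      · intro l _ hl
        rw [if_neg fun h => hl (Fin.ext h.symm), zero_mul]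
      · simp
    · rw [Finset.sum_eq_zero, if_neg (by omega)]
      intro l _
      rw [if_neg (by omega), zero_mul]

lemma pairBlock_pow (p : ℕ × ℕ) (r : ℕ) :
    pairBlock p ^ r = Matrix.fromBlocks (jordanBlock p.1 0 ^ r) 0 0 (jordanBlock p.2 0 ^ r) := by
  rw [pairBlock, Matrix.fromBlocks_diagonal_pow]

lemma jordanBlock_zero_pow_self (k : ℕ) : jordanBlock k 0 ^ k = 0 := by
  ext i j
  rw [jordanBlock_zero_pow_apply, if_neg (by omega)]
  rfl

lemma isNilpotent_pairBlock (p : ℕ × ℕ) : IsNilpotent (pairBlock p) := by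
  refine ⟨p.1 + p.2, ?_⟩
  rw [pairBlock_pow, pow_add, jordanBlock_zero_pow_self, zero_mul, pow_add,
    jordanBlock_zero_pow_self, mul_zero, Matrix.fromBlocks_zero]

/-- The kernel of each block is spanned by its first basis vector, which the `k`-th power of the
block reaches from the last one. Equal block sizes let one exponent serve both. -/
lemma exists_pairBlock_pow_mulVec_eq (k : ℕ) {u : Fin (k + 1) ⊕ Fin (k + 1) → ℂ}
    (hu : pairBlock (k + 1, k + 1) *ᵥ u = 0) :
    ∃ w, u = pairBlock (k + 1, k + 1) ^ k *ᵥ w := by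
  have key : ∀ u : Fin (k + 1) → ℂ, jordanBlock (k + 1) 0 *ᵥ u = 0 →
      u = jordanBlock (k + 1) 0 ^ k *ᵥ fun _ => u 0 := by
    intro u hu
    ext i
    simp only [Matrix.mulVec, dotProduct, jordanBlock_zero_pow_apply]
    rcases Fin.eq_zero_or_eq_succ i with rfl | ⟨j, rfl⟩
    · rw [Finset.sum_eq_single (Fin.last k)]
      · simp
      · intro l _ hl
        rw [if_neg fun h => hl (Fin.ext (by simpa using h.symm)), zero_mul]
      · simp
    · rw [Finset.sum_eq_zero fun l _ => by
        rw [if_neg (by simp only [Fin.val_succ]; omega), zero_mul]]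
      have := congrFun hu j.castSucc
      rw [← pow_one (jordanBlock (k + 1) 0)] at this
      simp only [Matrix.mulVec, dotProduct, jordanBlock_zero_pow_apply] at this
      rw [Finset.sum_eq_single j.succ] at this
      · simpa using this
      · intro l _ hl
        rw [if_neg fun h => hl (Fin.ext (by simpa using h.symm)), zero_mul]
      · simp
  rw [pairBlock, Matrix.fromBlocks_mulVec] at hu
  have h1 := key (u ∘ Sum.inl) (by
    ext i; simpa using congrFun hu (Sum.inl i))
  have h2 := key (u ∘ Sum.inr) (by
    ext i; simpa using congrFun hu (Sum.inr i))
  refine ⟨Sum.elim (fun _ => u (Sum.inl 0)) fun _ => u (Sum.inr 0), ?_⟩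
  rw [pairBlock_pow, Matrix.fromBlocks_mulVec]
  ext (i | i)
  · simpa [Function.comp_def] using congrFun h1 i
  · simpa [Function.comp_def] using congrFun h2 i

lemma eq_zero_of_ker_mul_self_le {m : Type*} [Fintype m] [DecidableEq m] {X : Matrix m m ℂ}
    (hX : IsNilpotent X) (hker : ∀ u, (X * X) *ᵥ u = 0 → X *ᵥ u = 0) : X = 0 := by
  obtain ⟨r, hr⟩ := hX
  induction r with
  | zero =>
    have h1 : (1 : Matrix m m ℂ) = 0 := by simpa using hr
    rw [← Matrix.mul_one X, h1, Matrix.mul_zero]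
  | succ r ih =>
    rcases r with _ | r
    · simpa using hr
    · refine ih (Matrix.ext_of_mulVec_single fun i => ?_)
      have : (X * X) *ᵥ (X ^ r *ᵥ Pi.single i 1) = 0 := by
        rw [Matrix.mulVec_mulVec, Matrix.mul_assoc, ← pow_succ', ← pow_succ', hr,
          Matrix.zero_mulVec]
      rw [pow_succ', ← Matrix.mulVec_mulVec, hker _ this, Matrix.zero_mulVec]

/-- A nilpotent matrix of size `a + b` is one block as soon as its power `a + b - 1` is nonzero, so
the proof refutes the vanishing of that power. -/
lemma IsPairSqrt.similar {p : ℕ × ℕ}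
    {X : Matrix (Fin p.1 ⊕ Fin p.2) (Fin p.1 ⊕ Fin p.2) ℂ} (hX : IsPairSqrt p X)
    (h0 : 0 < p.1) (h1 : p.2 ≤ p.1) (h2 : p.1 ≤ p.2 + 1) :
    Similar X (jordanBlock (p.1 + p.2) 0) := by
  have hnil : IsNilpotent X := by
    obtain ⟨r, hr⟩ := isNilpotent_pairBlock p
    refine ⟨2 * r, ?_⟩
    rw [pow_mul, pow_two, hX.1, hr]
  refine similar_jordanBlock_of_pow_ne_zero (by simp) hnil fun hpow => ?_
  obtain ⟨a, b⟩ := p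
  obtain ⟨hsq, hne⟩ := hX
  dsimp only at h0 h1 h2 hpow
  obtain rfl | rfl : a = b + 1 ∨ a = b := by omega
  -- Here `a + b - 1 = 2 * b`, so `X ^ (2 * b) = 0` would kill the `b`-th power of a block of size
  -- `b + 1`.
  · have h3 : pairBlock (b + 1, b) ^ b = 0 := by
      rw [← hsq, ← pow_two, ← pow_mul, show 2 * b = b + 1 + b - 1 by omega, hpow]
    rw [pairBlock_pow] at h3
    have h4 := congrFun (congrFun h3 (Sum.inl 0)) (Sum.inl (Fin.last b))
    rw [Matrix.fromBlocks_apply₁₁, jordanBlock_zero_pow_apply] at h4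
    simp at h4
  · obtain ⟨k, rfl⟩ : ∃ k, a = k + 1 := ⟨a - 1, by omega⟩
    -- A vector killed by `X²` has the form `X^(2k) w`, so `X` sends it to `X^(2k+1) w = 0`. Thus
    -- `ker X² ≤ ker X`, which forces the nilpotent `X` to vanish.
    have hX0 : X = 0 := by
      refine eq_zero_of_ker_mul_self_le hnil fun u hu => ?_
      rw [hsq] at hu
      obtain ⟨w, rfl⟩ := exists_pairBlock_pow_mulVec_eq k hu
      rw [Matrix.mulVec_mulVec, ← hsq, ← pow_two, ← pow_mul, ← pow_succ',
        show 2 * k + 1 = k + 1 + (k + 1) - 1 by omega, hpow, Matrix.zero_mulVec]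
    -- For `k = 0` this is the excluded zero root of `(1, 1)`; for `k > 0` the pair block is
    -- nonzero.
    rcases Nat.eq_zero_or_pos k with rfl | hk
    · exact hne rfl hX0
    · rw [hX0, Matrix.mul_zero] at hsq
      have h4 := congrFun (congrFun hsq (Sum.inl 0)) (Sum.inl ⟨1, by simp only; omega⟩)
      rw [← pow_one (pairBlock _), pairBlock_pow, Matrix.fromBlocks_apply₁₁,
        jordanBlock_zero_pow_apply] at h4
      simp at h4

/-- The condition on a pair `(a, b)` of a Segre pairing: `1 ≤ a`, `b ≤ a` and `a - b ≤ 1`. -/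
def IsAdmissiblePair (p : ℕ × ℕ) : Prop := 0 < p.1 ∧ p.2 ≤ p.1 ∧ p.1 ≤ p.2 + 1

lemma exists_isPairSqrt {p : ℕ × ℕ} (hp : IsAdmissiblePair p) : ∃ X, IsPairSqrt p X := by
  obtain ⟨h0, h1, h2⟩ := hp
  -- The square of `J_{a+b}(0)` shifts by two and preserves parity: the even positions carry
  -- `J_a(0)`, the odd ones `J_b(0)`.
  let F : Fin p.1 ⊕ Fin p.2 → Fin (p.1 + p.2) :=
    Sum.elim (fun i => ⟨2 * i, by omega⟩) (fun i => ⟨2 * i + 1, by omega⟩)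
  have hF : Function.Bijective F := by
    rw [Fintype.bijective_iff_injective_and_card]
    refine ⟨?_, by simp⟩
    rintro (i | i) (j | j) h <;> have h' := congrArg Fin.val h <;>
      simp only [F, Sum.elim_inl, Sum.elim_inr] at h'
    · exact congrArg _ (Fin.ext (by omega))
    · omega
    · omega
    · exact congrArg _ (Fin.ext (by omega))
  refine ⟨(jordanBlock (p.1 + p.2) 0).submatrix F F, ?_, ?_⟩
  · rw [← Matrix.submatrix_mul _ _ _ _ _ hF, ← pow_two, ← pow_one (pairBlock p), pairBlock_pow]
    ext (i | i) (j | j) <;>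
      simp only [Matrix.submatrix_apply, Matrix.fromBlocks_apply₁₁, Matrix.fromBlocks_apply₁₂,
        Matrix.fromBlocks_apply₂₁, Matrix.fromBlocks_apply₂₂, jordanBlock_zero_pow_apply,
        F, Sum.elim_inl, Sum.elim_inr, Matrix.zero_apply]
    · congr 1; simp only [eq_iff_iff]; omega
    · rw [if_neg (by omega)]
    · rw [if_neg (by omega)]
    · congr 1; simp only [eq_iff_iff]; omega
  · rintro rfl h
    have := congrFun (congrFun h (Sum.inl 0)) (Sum.inr 0)
    rw [← pow_one (jordanBlock _ _), Matrix.submatrix_apply, jordanBlock_zero_pow_apply] at this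
    simp [F] at this

/-! ### Direct sums over families of pairs -/

section PairSum

variable {ι : Type*} [Fintype ι] [DecidableEq ι]

/-- The block sizes `a` and `b` of a family of pairs `(a, b)`, with eigenvalue `0`. -/
def pairEntries (g : ι → ℕ × ℕ) : ι ⊕ ι → ℕ × ℂ :=
  Sum.elim (fun i => ((g i).1, 0)) (fun i => ((g i).2, 0))

lemma blockDiagonal'_pairBlock_similar (g : ι → ℕ × ℕ) :
    Similar (Matrix.blockDiagonal' fun i => pairBlock (g i)) (jordanSum (pairEntries g)) := by
  let F : (Σ i, Fin (g i).1 ⊕ Fin (g i).2) → Σ s, Fin (pairEntries g s).1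
    | ⟨i, Sum.inl x⟩ => ⟨Sum.inl i, x⟩
    | ⟨i, Sum.inr x⟩ => ⟨Sum.inr i, x⟩
  have hF : Function.Bijective F := by
    constructor
    · rintro ⟨i, x | x⟩ ⟨j, y | y⟩ h <;> obtain ⟨h1, h2⟩ := Sigma.mk.inj_iff.1 h <;>
        cases h1 <;> cases h2 <;> rfl
    · rintro ⟨i | i, x⟩
      · exact ⟨⟨i, Sum.inl x⟩, rfl⟩
      · exact ⟨⟨i, Sum.inr x⟩, rfl⟩
  have := similar_submatrix (jordanSum (pairEntries g)) (Equiv.ofBijective F hF)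
  convert this using 1
  ext ⟨i, x⟩ ⟨j, y⟩
  simp only [Matrix.submatrix_apply, Equiv.ofBijective_apply]
  by_cases hij : i = j
  · subst hij
    rcases x with x | x <;> rcases y with y | y <;>
      simp [F, jordanSum, pairBlock, pairEntries, Matrix.blockDiagonal'_apply] <;> rfl
  · rw [Matrix.blockDiagonal'_apply_ne _ _ _ hij]
    rcases x with x | x <;> rcases y with y | y <;>
      simp [F, jordanSum, Matrix.blockDiagonal'_apply, hij]

lemma blockDiagonal'_isPairSqrt_similar {g : ι → ℕ × ℕ} (hg : ∀ i, IsAdmissiblePair (g i))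
    {X : ∀ i, Matrix (Fin (g i).1 ⊕ Fin (g i).2) (Fin (g i).1 ⊕ Fin (g i).2) ℂ}
    (hX : ∀ i, IsPairSqrt (g i) (X i)) :
    Similar (Matrix.blockDiagonal' X) (jordanSum fun i => ((g i).1 + (g i).2, (0 : ℂ))) :=
  Similar.blockDiagonal' fun i => (hX i).similar (hg i).1 (hg i).2.1 (hg i).2.2

/-- Each `J_{a+b}(0)` is similar to a root of its pair block, so squaring gives the pair blocks
back. -/
lemma jordanSum_mul_self_similar {g : ι → ℕ × ℕ} (hg : ∀ i, IsAdmissiblePair (g i)) :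
    Similar (jordanSum (fun i => ((g i).1 + (g i).2, (0 : ℂ))) *
      jordanSum fun i => ((g i).1 + (g i).2, (0 : ℂ))) (jordanSum (pairEntries g)) := by
  choose X hX using fun i => exists_isPairSqrt (hg i)
  refine (blockDiagonal'_isPairSqrt_similar hg hX).mul_self.symm.trans ?_
  rw [← Matrix.blockDiagonal'_mul, funext fun i => (hX i).1]
  exact blockDiagonal'_pairBlock_similar g

end PairSum

/-! ### The correspondence between Segre pairings and Jordan forms -/

lemma filter_map_pairEntries {ι : Type*} [Fintype ι] (g : ι → ℕ × ℕ) :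
    (univ.val.map (pairEntries g)).filter (fun b => 0 < b.1) =
      (((univ.val.map g).map Prod.fst + (univ.val.map g).map Prod.snd).filter
        (fun k => k ≠ 0)).map fun k => (k, 0) := by
  rw [← Finset.univ_disjSum_univ, Finset.val_disjSum, Multiset.disjSum, Multiset.map_add,
    Multiset.map_map, Multiset.map_map, Multiset.filter_add, Multiset.filter_add, Multiset.map_add]
  simp only [Multiset.map_map, Multiset.filter_map, Function.comp_def, pairEntries, Sum.elim_inl,
    Sum.elim_inr, Nat.pos_iff_ne_zero]
  congr!

/-- The Jordan form attached to a collection of pairs: each `(a, b)` gives a block of size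
`a + b` with eigenvalue `0`. -/
def jordanFormOfPairs (S : Multiset (ℕ × ℕ)) : Multiset (ℕ × ℂ) :=
  S.map fun p => (p.1 + p.2, 0)

variable {n : ℕ} {B : Matrix (Fin n) (Fin n) ℂ}

lemma mem_segrePairings_iff (hB : IsNilpotent B) {ι : Type*} [Fintype ι] [DecidableEq ι]
    (g : ι → ℕ × ℕ) : univ.val.map g ∈ segrePairings B ↔
      (∀ i, IsAdmissiblePair (g i)) ∧ Similar B (jordanSum (pairEntries g)) := by
  rw [← hasJordanForm_filter_iff, filter_map_pairEntries, ← hasSegreChar_zero_iff hB]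
  constructor
  · rintro ⟨_, hs, hg, rfl⟩
    exact ⟨fun i => hg _ (Multiset.mem_map_of_mem g (Finset.mem_univ i)), hs⟩
  · rintro ⟨hg, hs⟩
    refine ⟨_, hs, fun p hp => ?_, rfl⟩
    obtain ⟨i, -, rfl⟩ := Multiset.mem_map.1 hp
    exact hg i

lemma IsAssociatedSqrt.mul_self_eq {S : Multiset (ℕ × ℕ)} {A : Matrix (Fin n) (Fin n) ℂ}
    (h : IsAssociatedSqrt B S A) : A * A = B := by
  obtain ⟨l, -, X, P, Q, hX, hPQ, hQP, rfl, rfl⟩ := h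
  rw [show ∀ M : Matrix _ _ ℂ, P * M * Q * (P * M * Q) = P * (M * (Q * P) * M) * Q from
    fun M => by simp only [Matrix.mul_assoc], hQP, Matrix.mul_one, ← Matrix.blockDiagonal'_mul,
    funext fun i => (hX i).1]

lemma IsAssociatedSqrt.hasJordanForm {S : Multiset (ℕ × ℕ)} (hS : ∀ p ∈ S, IsAdmissiblePair p)
    {A : Matrix (Fin n) (Fin n) ℂ} (h : IsAssociatedSqrt B S A) :
    HasJordanForm A (jordanFormOfPairs S) := by
  obtain ⟨l, rfl, X, P, Q, hX, hPQ, hQP, -, hA⟩ := h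
  have hA' : Similar A (Matrix.blockDiagonal' X) := ⟨P, Q, hPQ, hQP, hA⟩
  have := (hasJordanForm_filter_iff A _).2
    (hA'.trans (blockDiagonal'_isPairSqrt_similar (fun i => hS _ (List.get_mem l i)) hX))
  convert this using 1
  -- Every `a + b` is positive, so the filter discards nothing.
  rw [← map_univ_get l, jordanFormOfPairs, Multiset.map_map, eq_comm, Multiset.filter_eq_self.2]
  · rfl
  · intro b hb
    obtain ⟨i, -, rfl⟩ := Multiset.mem_map.1 hb
    exact Nat.add_pos_left (hS _ (List.get_mem l i)).1 _

lemma exists_isAssociatedSqrt (hB : IsNilpotent B) {S : Multiset (ℕ × ℕ)}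
    (hS : S ∈ segrePairings B) : ∃ A, IsAssociatedSqrt B S A := by
  obtain ⟨l, rfl⟩ := Quot.exists_rep S
  have hl : univ.val.map l.get ∈ segrePairings B := by rwa [map_univ_get]
  obtain ⟨hg, hsim⟩ := (mem_segrePairings_iff hB l.get).1 hl
  choose X hX using fun i => exists_isPairSqrt (hg i)
  obtain ⟨P, Q, hPQ, hQP, hBP⟩ := hsim.trans (blockDiagonal'_pairBlock_similar l.get).symm
  exact ⟨P * Matrix.blockDiagonal' X * Q, l, rfl, X, P, Q, hX, hPQ, hQP, hBP, rfl⟩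

/-- Admissibility forces `a = ⌈(a+b)/2⌉` and `b = ⌊(a+b)/2⌋`, so block sizes determine the pairs. -/
lemma injOn_jordanFormOfPairs :
    Set.InjOn jordanFormOfPairs {S | ∀ p ∈ S, IsAdmissiblePair p} := by
  have key : ∀ S : Multiset (ℕ × ℕ), (∀ p ∈ S, IsAdmissiblePair p) →
      (jordanFormOfPairs S).map (fun b => ((b.1 + 1) / 2, b.1 / 2)) = S := by
    intro S hS
    rw [jordanFormOfPairs, Multiset.map_map]
    conv_rhs => rw [← Multiset.map_id S]
    refine Multiset.map_congr rfl fun p hp => ?_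
    obtain ⟨h0, h1, h2⟩ := hS p hp
    exact Prod.ext (by simp only [Function.comp_apply, id]; omega)
      (by simp only [Function.comp_apply, id]; omega)
  intro S hS S' hS' h
  rw [← key S hS, h, key S' hS']

lemma exists_segrePairing_of_sqrt {A : Matrix (Fin n) (Fin n) ℂ} (hA : IsNilpotent A)
    (hB : IsNilpotent B) (hAB : A * A = B) {J : Multiset (ℕ × ℂ)} (hJ : HasJordanForm A J) :
    ∃ S ∈ segrePairings B, jordanFormOfPairs S = J := by
  have h0 := hJ.snd_eq_zero hA
  obtain ⟨l, rfl, hpos, hsim⟩ := hJ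
  let g : Fin l.length → ℕ × ℕ := fun i => (((l.get i).1 + 1) / 2, (l.get i).1 / 2)
  have hgl : (fun i => ((g i).1 + (g i).2, (0 : ℂ))) = l.get := funext fun i =>
    Prod.ext (by simp only [g]; omega) (h0 _ (List.get_mem l i)).symm
  have hg : ∀ i, IsAdmissiblePair (g i) := fun i => by
    have := hpos _ (List.get_mem l i)
    simp only [IsAdmissiblePair, g]
    omega
  refine ⟨univ.val.map g, (mem_segrePairings_iff hB g).2 ⟨hg, ?_⟩, ?_⟩
  · have hsim' : Similar A (jordanSum l.get) := hsim
    rw [← hgl] at hsim'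
    exact hAB ▸ hsim'.mul_self.trans (jordanSum_mul_self_similar hg)
  · rw [jordanFormOfPairs, Multiset.map_map, ← map_univ_get l, ← hgl]
    rfl

end IndefiniteRoots

theorem mainTheorem10 (n : ℕ) (H B : Matrix (Fin n) (Fin n) ℂ)
    (hH : H.IsHermitian) (hHinv : IsUnit H)
    (hB : IndefiniteRoots.IsHNonneg H B) (hnil : IsNilpotent B) :
    ∃ Φ : Multiset (ℕ × ℕ) → Multiset (ℕ × ℂ),
      Set.BijOn Φ (IndefiniteRoots.segrePairings B) (IndefiniteRoots.sqrtJordanForms B) ∧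
      ∀ S ∈ IndefiniteRoots.segrePairings B,
        (∃ A, IndefiniteRoots.IsAssociatedSqrt B S A) ∧
        ∀ A, IndefiniteRoots.IsAssociatedSqrt B S A →
          A * A = B ∧ IndefiniteRoots.HasJordanForm A (Φ S) := by
  have hadm : ∀ S ∈ IndefiniteRoots.segrePairings B, ∀ p ∈ S,
      IndefiniteRoots.IsAdmissiblePair p := fun S ⟨_, _, hS⟩ => hS.1
  have hass : ∀ S ∈ IndefiniteRoots.segrePairings B, ∀ A,
      IndefiniteRoots.IsAssociatedSqrt B S A →
        A * A = B ∧ IndefiniteRoots.HasJordanForm A (IndefiniteRoots.jordanFormOfPairs S) :=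
    fun S hS A hA => ⟨hA.mul_self_eq, hA.hasJordanForm (hadm S hS)⟩
  refine ⟨IndefiniteRoots.jordanFormOfPairs, ⟨fun S hS => ?_, ?_, ?_⟩, fun S hS =>
    ⟨IndefiniteRoots.exists_isAssociatedSqrt hnil hS, hass S hS⟩⟩
  · obtain ⟨A, hA⟩ := IndefiniteRoots.exists_isAssociatedSqrt hnil hS
    exact ⟨A, hass S hS A hA⟩
  · exact IndefiniteRoots.injOn_jordanFormOfPairs.mono hadm
  · rintro J ⟨A, hAB, hJ⟩
    -- `A ^ (2 * r) = B ^ r = 0`.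
    have hA : IsNilpotent A := by
      obtain ⟨r, hr⟩ := hnil
      exact ⟨2 * r, by rw [pow_mul, pow_two, hAB, hr]⟩
    exact IndefiniteRoots.exists_segrePairing_of_sqrt hA hnil hAB hJ
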